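/- Let $k$ be a field, let $A^\bullet$ and $B^\bullet$ be cochain complexes of $k$-vector spaces indexed by $\mathbb{Z}$ (arbitrary otherwise; complexes indexed by $\mathbb{N}$ are extended by $0$), and let $S^i : A^i \to B^{i+1}$ be linear maps that either commute with the differentials, or anticommute with them; that is, $S^{i+1}\mathrm{d} = \varepsilon\, \mathrm{d} S^i$ for all $i$, with a fixed $\varepsilon \in \{1,-1\}$. Put $K^i = \ker S^i$, a complex with the differential of $A^\bullet$, and $C^i = \operatorname{coker}(S^{i-1}) = B^i/\operatorname{im} S^{i-1}$, a complex with the differential induced by that of $B^\bullet$. Consider the double complex with two rows that has $A^p$ and, above it, $B^{p+1}$ in column $p$, with vertical maps $S^p$. Its total complex is $Z^i = B^i \oplus A^i$ with differential $(b,a) \mapsto (\mathrm{d} b + S^i a, -\varepsilon\,\mathrm{d} a)$. In the spectral sequence of the filtration of $Z^\bullet$ by columns (the one that starts with the vertical maps), the two rows of the second page are identified with $\mathcal{H}^\bullet(C^\bullet)$ and $\mathcal{H}^\bullet(K^\bullet)$, and the differential of the second page is a family of linear maps $\phi^i : \mathcal{H}^i(C^\bullet) \to \mathcal{H}^{i+1}(K^\bullet)$.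 (Explicitly, $\phi^i[b] = [-\varepsilon\,\mathrm{d} a]$ whenever $b \in B^i$, $a \in A^i$ and $\mathrm{d} b + S^i a = 0$.) Suppose that the maps $\mathcal{H}^i(A^\bullet) \to \mathcal{H}^{i+1}(B^\bullet)$ induced by $S$ on cohomology are zero for all $i$. Let $\Phi^i : C^i \to K^{i+1}$ be linear maps with $\Phi^{i+1} \mathrm{d} = \eta\, \mathrm{d}\Phi^i$ for all $i$, with a fixed $\eta \in \{1,-1\}$, which induce the maps $\phi^i$ on cohomology for all $i$. Let $Y_\Phi^\bullet$ be the mapping cone of $\Phi$: the spaces $Y_\Phi^i = K^i \oplus C^i$ with the differential $(x,c) \mapsto (\mathrm{d} x + \Phi^i c, -\eta\,\mathrm{d} c)$. Then, for every $i$, there are isomorphisms of vector spaces $$\mathcal{H}^i(Y_\Phi^\bullet) \;\cong\; \operatorname{coker} \phi^{i-1} \oplus \ker \phi^i \;\cong\; \mathcal{H}^i(A^\bullet) \oplus \mathcal{H}^i(B^\bullet).$$ -/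

import Mathlib

open CategoryTheory

universe u v

namespace BGG

noncomputable section

variable {k : Type u} [Field k]

/-- Cochain complexes of vector spaces over `k`, indexed by `ℤ`. -/
abbrev Cplx (k : Type u) [Field k] := CochainComplex (ModuleCat.{v} k) ℤ

/-- The differential `X^i → X^j` as a linear map (zero unless `i + 1 = j`). -/
abbrev diff (X : Cplx.{u, v} k) (i j : ℤ) : X.X i →ₗ[k] X.X j := (X.d i j).hom

lemma diff_diff (X : Cplx.{u, v} k) (i j l : ℤ) (x : X.X i) :
    diff X j l (diff X i j x) = 0 :=
  LinearMap.congr_fun (congrArg ModuleCat.Hom.hom (X.d_comp_d i j l)) x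

lemma diff_shape (X : Cplx.{u, v} k) (i j : ℤ) (h : i + 1 ≠ j) : diff X i j = 0 := by
  have := X.shape i j (by simpa using h)
  simp [diff, this]

lemma map_units_zsmul {M N : Type*} [AddCommGroup M] [AddCommGroup N] [Module k M] [Module k N]
    (f : M →ₗ[k] N) (ε : ℤˣ) (x : M) : f (ε • x) = ε • f x :=
  map_zsmul f (ε : ℤ) x

/-- Cocycles of degree `i`. -/
abbrev cocycles (X : Cplx.{u, v} k) (i : ℤ) : Submodule k (X.X i) :=
  LinearMap.ker (diff X i (i + 1))

/-- Coboundaries of degree `i`. -/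
abbrev coboundaries (X : Cplx.{u, v} k) (i : ℤ) : Submodule k (X.X i) :=
  LinearMap.range (diff X (i - 1) i)

lemma diff_mem_coboundaries (X : Cplx.{u, v} k) (i j : ℤ) (x : X.X i) :
    diff X i j x ∈ coboundaries X j := by
  by_cases h : i + 1 = j
  · obtain rfl : i = j - 1 := by omega
    exact ⟨x, rfl⟩
  · rw [diff_shape X i j h]
    exact Submodule.zero_mem _

/-- The homology of a complex, as provided by Mathlib, is cocycles modulo coboundaries. -/
def homologyEquiv (X : Cplx.{u, v} k) (i : ℤ) :
    (cocycles X i ⧸ (coboundaries X i).submoduleOf (cocycles X i)) ≃ₗ[k] X.homology i :=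
  (Submodule.quotEquivOfEq _ _ (by
    ext x
    constructor
    · rintro ⟨y, hy⟩
      exact ⟨y, Subtype.ext hy⟩
    · rintro ⟨y, hy⟩
      exact ⟨y, congrArg Subtype.val hy⟩)).trans
  ((X.homologyIsoSc' (i - 1) i (i + 1) (by simp) (by simp)).trans
    (X.sc' (i - 1) i (i + 1)).moduleCatHomologyIso).toLinearEquiv.symm

/-- The cohomology class of a cocycle. -/
def cls (X : Cplx.{u, v} k) (i : ℤ) : cocycles X i →ₗ[k] X.homology i :=
  (homologyEquiv X i).toLinearMap ∘ₗ Submodule.mkQ _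

lemma cls_surjective (X : Cplx.{u, v} k) (i : ℤ) : Function.Surjective (cls X i) :=
  (homologyEquiv X i).surjective.comp (Submodule.mkQ_surjective _)

lemma cls_eq_zero_iff (X : Cplx.{u, v} k) (i : ℤ) (x : cocycles X i) :
    cls X i x = 0 ↔ (x : X.X i) ∈ coboundaries X i := by
  simp only [cls, LinearMap.comp_apply, LinearEquiv.coe_coe, LinearEquiv.map_eq_zero_iff,
    Submodule.mkQ_apply, Submodule.Quotient.mk_eq_zero]
  rfl

/-- Maps `S^i : A^i → B^{i+1}` that commute (`ε = 1`) or anticommute (`ε = -1`) with the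
differentials. As for differentials, `map i j` is defined for all `i`, `j` and vanishes
unless `i + 1 = j`. -/
structure DegOneMap (ε : ℤˣ) (A B : Cplx.{u, v} k) where
  map (i j : ℤ) : A.X i →ₗ[k] B.X j
  shape (i j : ℤ) (h : i + 1 ≠ j) : map i j = 0
  comm (i j l : ℤ) (x : A.X i) : map j l (diff A i j x) = ε • diff B j l (map i j x)

namespace DegOneMap

variable {ε : ℤˣ} {A B : Cplx.{u, v} k} (S : DegOneMap ε A B)

lemma comm' (i j l : ℤ) (x : A.X i) : diff B j l (S.map i j x) = ε • S.map j l (diff A i j x) := by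
  rw [S.comm, smul_smul, Int.units_mul_self, one_smul]

lemma mem_range (i j : ℤ) (x : A.X i) : S.map i j x ∈ LinearMap.range (S.map (j - 1) j) := by
  by_cases h : i + 1 = j
  · obtain rfl : i = j - 1 := by omega
    exact ⟨x, rfl⟩
  · rw [S.shape i j h]
    exact Submodule.zero_mem _

lemma exists_of_mem_range (i j : ℤ) (h : i + 1 = j) (y : B.X j)
    (hy : y ∈ LinearMap.range (S.map (j - 1) j)) : ∃ x : A.X i, S.map i j x = y := by
  obtain rfl : i = j - 1 := by omega
  exact hy

lemma map_eq_zero_congr (i j l : ℤ) (h : j = l) (x : A.X i) :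
    S.map i j x = 0 ↔ S.map i l x = 0 := by
  subst h
  rfl

/-- The map `H^i(A) → H^j(B)`, `j = i + 1`, induced by `S` on cohomology: `[a] ↦ [S a]`. -/
def onCohomology (i j : ℤ) (h : i + 1 = j) : A.homology i →ₗ[k] B.homology j :=
  (Submodule.liftQ _
    (cls B j ∘ₗ (S.map i j).restrict (p := cocycles A i) (q := cocycles B j) (by
      intro x hx
      subst h
      rw [LinearMap.mem_ker] at hx ⊢
      rw [S.comm', hx, map_zero, smul_zero]))
    (by
      intro x hx
      obtain ⟨y, hy⟩ := hx
      rw [LinearMap.mem_ker, LinearMap.comp_apply, cls_eq_zero_iff]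
      change S.map i j x.1 ∈ _
      have hy' : diff A (i - 1) i y = x.1 := hy
      rw [← hy', S.comm, ← map_units_zsmul]
      exact diff_mem_coboundaries B i j _)) ∘ₗ (homologyEquiv A i).symm.toLinearMap

lemma onCohomology_cls (i j : ℤ) (h : i + 1 = j) (x : cocycles A i)
    (hx : S.map i j x ∈ cocycles B j) :
    S.onCohomology i j h (cls A i x) = cls B j ⟨S.map i j x, hx⟩ := by
  simp only [onCohomology, cls, LinearMap.comp_apply, LinearEquiv.coe_coe,
    LinearEquiv.symm_apply_apply]
  rfl

/-- The mapping cone of `S`: the spaces `B^i ⊕ A^i` with the differential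
`(b, a) ↦ (d b + S a, -ε d a)`. For `ε = -1` it is `(b, a) ↦ (d b + S a, d a)`. -/
def cone : Cplx.{u, v} k where
  X i := ModuleCat.of k (B.X i × A.X i)
  d i j := ModuleCat.ofHom
    (((diff B i j).coprod (S.map i j)).prod (-(ε • (diff A i j ∘ₗ LinearMap.snd k _ _))))
  shape i j h := by
    have h' : i + 1 ≠ j := by simpa using h
    rw [S.shape i j h', diff_shape A i j h', diff_shape B i j h']
    ext x <;> simp
  d_comp_d' i j l _ _ := by
    refine ModuleCat.hom_ext (LinearMap.ext fun x => Prod.ext ?_ ?_)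
    · change diff B j l (diff B i j x.1 + S.map i j x.2) + S.map j l (-(ε • diff A i j x.2)) = 0
      rw [map_add, diff_diff, map_neg, map_units_zsmul, S.comm']
      simp
    · change -(ε • diff A j l (-(ε • diff A i j x.2))) = 0
      rw [map_neg, map_units_zsmul, diff_diff]
      simp

/-- The element `(b, a)` of `B^i ⊕ A^i`. -/
def pair {i : ℤ} (b : B.X i) (a : A.X i) : S.cone.X i := ((b, a) : B.X i × A.X i)

/-- The component in `B^i`. -/
def toB (i : ℤ) : S.cone.X i →ₗ[k] B.X i := LinearMap.fst k (B.X i) (A.X i)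

/-- The component in `A^i`. -/
def toA (i : ℤ) : S.cone.X i →ₗ[k] A.X i := LinearMap.snd k (B.X i) (A.X i)

lemma cone_ext {i : ℤ} {x y : S.cone.X i} (hB : S.toB i x = S.toB i y)
    (hA : S.toA i x = S.toA i y) : x = y := Prod.ext hB hA

lemma exists_pair {i : ℤ} (x : S.cone.X i) : ∃ b a, x = S.pair b a := ⟨x.1, x.2, rfl⟩

lemma cone_diff (i j : ℤ) (b : B.X i) (a : A.X i) :
    diff S.cone i j (S.pair b a) = S.pair (diff B i j b + S.map i j a) (-(ε • diff A i j a)) := rfl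

/-- The complex `K^i = ker S^i`, with the differential of `A`. -/
def kerComplex : Cplx.{u, v} k where
  X i := ModuleCat.of k (LinearMap.ker (S.map i (i + 1)))
  d i j := ModuleCat.ofHom ((diff A i j).restrict (by
    intro x hx
    rw [LinearMap.mem_ker] at hx ⊢
    by_cases h : i + 1 = j
    · subst h
      rw [S.comm, hx, map_zero, smul_zero]
    · rw [diff_shape A i j h, LinearMap.zero_apply, map_zero]))
  shape i j h := by
    have h' : i + 1 ≠ j := by simpa using h
    ext x : 2
    apply Subtype.ext
    change diff A i j x.1 = 0
    rw [diff_shape A i j h', LinearMap.zero_apply]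
  d_comp_d' i j l _ _ := by
    ext x : 2
    apply Subtype.ext
    exact diff_diff A i j l x.1

/-- The complex `C^i = coker S^{i-1}`, with the differential induced by that of `B`. -/
def cokerComplex : Cplx.{u, v} k where
  X i := ModuleCat.of k (B.X i ⧸ LinearMap.range (S.map (i - 1) i))
  d i j := ModuleCat.ofHom (Submodule.mapQ _ _ (diff B i j) (by
    rintro _ ⟨y, rfl⟩
    rw [Submodule.mem_comap, S.comm']
    rw [← map_units_zsmul]
    exact S.mem_range i j _))
  shape i j h := by
    have h' : i + 1 ≠ j := by simpa using h
    refine ModuleCat.hom_ext (LinearMap.ext fun x => ?_)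
    obtain ⟨y, rfl⟩ := Submodule.mkQ_surjective _ x
    change Submodule.mkQ _ (diff B i j y) = 0
    rw [diff_shape B i j h', LinearMap.zero_apply, map_zero]
  d_comp_d' i j l _ _ := by
    refine ModuleCat.hom_ext (LinearMap.ext fun x => ?_)
    obtain ⟨y, rfl⟩ := Submodule.mkQ_surjective _ x
    change Submodule.mkQ _ (diff B j l (diff B i j y)) = 0
    rw [diff_diff, map_zero]

/-- The projection `B^i → C^i`. -/
def toCoker (i : ℤ) : B.X i →ₗ[k] S.cokerComplex.X i :=
  Submodule.mkQ (LinearMap.range (S.map (i - 1) i))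

/-- The inclusion `K^i → A^i`. -/
def kerIncl (i : ℤ) : S.kerComplex.X i →ₗ[k] A.X i :=
  (LinearMap.ker (S.map i (i + 1))).subtype

/-- An element of `K^i`. -/
def kerMk {i : ℤ} (a : A.X i) (h : S.map i (i + 1) a = 0) : S.kerComplex.X i :=
  (⟨a, h⟩ : LinearMap.ker (S.map i (i + 1)))

end DegOneMap

/-- A decreasing filtration `F^p X^n` of a complex by subcomplexes. -/
structure Filtration (X : Cplx.{u, v} k) where
  F (p n : ℤ) : Submodule k (X.X n)
  anti (p q n : ℤ) (h : p ≤ q) : F q n ≤ F p n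
  diff_mem (p n m : ℤ) (x : X.X n) (hx : x ∈ F p n) : diff X n m x ∈ F p m

namespace Filtration

variable {X : Cplx.{u, v} k} (Fil : Filtration X)

/-- `Z_r^p = {x ∈ F^p X^n | d x ∈ F^{p+r} X^{n+1}}`, in total degree `n`. -/
def Z (r p n : ℤ) : Submodule k (X.X n) :=
  Fil.F p n ⊓ (Fil.F (p + r) (n + 1)).comap (diff X n (n + 1))

/-- `Z_{r-1}^{p+1} + d Z_{r-1}^{p-r+1}`, in total degree `n`. -/
def Bd (r p n : ℤ) : Submodule k (X.X n) :=
  Fil.Z (r - 1) (p + 1) n ⊔ (Fil.Z (r - 1) (p - r + 1) (n - 1)).map (diff X (n - 1) n)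

/-- The term in filtration degree `p` and total degree `n` of the `r`-th page of the spectral
sequence of a filtered complex: `Z_r^p / (Z_{r-1}^{p+1} + d Z_{r-1}^{p-r+1})`. -/
abbrev page (r p n : ℤ) := Fil.Z r p n ⧸ (Fil.Bd r p n).submoduleOf (Fil.Z r p n)

lemma diff_mem_Z (r p q n m : ℤ) (hq : p + r = q) (hm : n + 1 = m) (x : X.X n)
    (hx : x ∈ Fil.Z r p n) : diff X n m x ∈ Fil.Z r q m := by
  subst hq hm
  refine ⟨hx.2, ?_⟩
  change diff X _ _ _ ∈ Fil.F _ _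
  rw [diff_diff]
  exact Submodule.zero_mem _

lemma diff_mem_Bd (r p q n m : ℤ) (hq : p + r = q) (hm : n + 1 = m) (x : X.X n)
    (hx : x ∈ Fil.Bd r p n) : diff X n m x ∈ Fil.Bd r q m := by
  obtain ⟨y, hy, _, ⟨z, _, rfl⟩, rfl⟩ := Submodule.mem_sup.1 hx
  rw [map_add, diff_diff, add_zero]
  obtain rfl : n = m - 1 := by omega
  obtain rfl : p = q - r := by omega
  exact Submodule.mem_sup_right ⟨y, hy, rfl⟩

/-- The differential of the `r`-th page, induced by the differential of the complex. -/
def pageDiff (r p q n m : ℤ) (hq : p + r = q) (hm : n + 1 = m) :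
    Fil.page r p n →ₗ[k] Fil.page r q m :=
  Submodule.mapQ _ _ ((diff X n m).restrict (Fil.diff_mem_Z r p q n m hq hm))
    (fun x hx => Fil.diff_mem_Bd r p q n m hq hm x hx)

end Filtration

namespace DegOneMap

variable {ε : ℤˣ} {A B : Cplx.{u, v} k} (S : DegOneMap ε A B)

/-- The two-row double complex has `A^p` and, above it, `B^{p+1}` in column `p`; its total complex
is the mapping cone of `S`. This is the filtration of the total complex by columns: `F^p` consists
of the entries in columns `≥ p`, where `A^n` is in column `n` and `B^n` in column `n - 1`. Its
spectral sequence is the one that starts with the vertical maps `S`. -/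
def columnFiltration : Filtration S.cone where
  F p n :=
    { carrier := {x : B.X n × A.X n | (n - 1 < p → x.1 = 0) ∧ (n < p → x.2 = 0)}
      zero_mem' := ⟨fun _ => rfl, fun _ => rfl⟩
      add_mem' := by
        rintro ⟨b, a⟩ ⟨b', a'⟩ ⟨h1, h2⟩ ⟨h1', h2'⟩
        refine ⟨fun h => ?_, fun h => ?_⟩
        · change b + b' = 0
          rw [show b = 0 from h1 h, show b' = 0 from h1' h, add_zero]
        · change a + a' = 0
          rw [show a = 0 from h2 h, show a' = 0 from h2' h, add_zero]
      smul_mem' := by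
        rintro c ⟨b, a⟩ ⟨h1, h2⟩
        refine ⟨fun h => ?_, fun h => ?_⟩
        · change c • b = 0
          rw [show b = 0 from h1 h, smul_zero]
        · change c • a = 0
          rw [show a = 0 from h2 h, smul_zero] }
  anti p q n h := fun _ hx => ⟨fun h' => hx.1 (by omega), fun h' => hx.2 (by omega)⟩
  diff_mem p n m := by
    rintro ⟨b, a⟩ ⟨h1, h2⟩
    by_cases hm : n + 1 = m
    · subst hm
      refine ⟨fun h => ?_, fun h => ?_⟩
      · change diff B n (n + 1) b + S.map n (n + 1) a = 0
        rw [show b = 0 from h1 (by omega), show a = 0 from h2 (by omega), map_zero, map_zero,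
          add_zero]
      · change -(ε • diff A n (n + 1) a) = 0
        rw [show a = 0 from h2 (by omega), map_zero, smul_zero, neg_zero]
    · rw [diff_shape S.cone n m hm]
      exact Submodule.zero_mem _

lemma mem_columnFiltration (p n : ℤ) (x : B.X n × A.X n) :
    x ∈ S.columnFiltration.F p n ↔ (n - 1 < p → x.1 = 0) ∧ (n < p → x.2 = 0) := Iff.rfl

lemma mem_Z_top (p n : ℤ) (hp : p = n - 1) (b : B.X n) (a : A.X n) :
    (S.pair b a) ∈ S.columnFiltration.Z 2 p n ↔
      diff B n (n + 1) b + S.map n (n + 1) a = 0 := by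
  subst hp
  constructor
  · intro h
    exact h.2.1 (by omega)
  · intro h
    exact ⟨⟨fun h' => by omega, fun h' => by omega⟩, fun _ => h, fun h' => by omega⟩

lemma mem_Z_bot (p n : ℤ) (hp : p = n) (b : B.X n) (a : A.X n) :
    (S.pair b a) ∈ S.columnFiltration.Z 2 p n ↔
      b = 0 ∧ S.map n (n + 1) a = 0 ∧ diff A n (n + 1) a = 0 := by
  subst hp
  constructor
  · intro h
    have hb : b = 0 := h.1.1 (by omega)
    have h1 : diff B p (p + 1) b + S.map p (p + 1) a = 0 := h.2.1 (by omega)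
    have h2 : -(ε • diff A p (p + 1) a) = 0 := h.2.2 (by omega)
    subst hb
    refine ⟨rfl, by simpa using h1, (smul_eq_zero_iff_eq ε).1 (neg_eq_zero.1 h2)⟩
  · rintro ⟨rfl, h1, h2⟩
    refine ⟨⟨fun _ => rfl, fun h' => by omega⟩, fun _ => ?_, fun _ => ?_⟩
    · change diff B p (p + 1) 0 + S.map p (p + 1) a = 0
      rw [map_zero, zero_add, h1]
    · change -(ε • diff A p (p + 1) a) = 0
      rw [h2, smul_zero, neg_zero]

lemma mem_Bd_top (p n : ℤ) (hp : p = n - 1) (b : B.X n) (a : A.X n)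
    (h : (S.pair b a) ∈ S.columnFiltration.Z 2 p n) :
    (S.pair b a) ∈ S.columnFiltration.Bd 2 p n ↔
      ∃ (b' : B.X (n - 1)) (a' : A.X (n - 1)), b = diff B (n - 1) n b' + S.map (n - 1) n a' := by
  subst hp
  rw [mem_Z_top S _ n rfl] at h
  constructor
  · intro hx
    obtain ⟨y, hy, _, ⟨z, _, rfl⟩, e⟩ := Submodule.mem_sup.1 hx
    obtain ⟨y1, y2, rfl⟩ := S.exists_pair y
    obtain ⟨b', a', rfl⟩ := S.exists_pair z
    have hy1 : y1 = 0 := hy.1.1 (by omega)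
    have e1 : y1 + (diff B (n - 1) n b' + S.map (n - 1) n a') = b := congrArg (S.toB _) e
    exact ⟨b', a', by rw [← e1, hy1, zero_add]⟩
  · rintro ⟨b', a', rfl⟩
    refine Submodule.mem_sup.2 ⟨S.pair 0 (a + ε • diff A (n - 1) n a'), ?_,
      diff S.cone (n - 1) n (S.pair b' a'), ⟨_, ?_, rfl⟩, ?_⟩
    · refine ⟨⟨fun _ => rfl, fun h' => by omega⟩, fun _ => ?_, fun h' => by omega⟩
      change diff B n (n + 1) 0 + S.map n (n + 1) (a + ε • diff A (n - 1) n a') = 0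
      rw [map_add, diff_diff, zero_add, S.comm'] at h
      rw [map_zero, zero_add, map_add, map_units_zsmul, add_comm (S.map _ _ a), h]
    · exact ⟨⟨fun h' => by omega, fun h' => by omega⟩, fun h' => by omega, fun h' => by omega⟩
    · rw [cone_diff]
      refine S.cone_ext ?_ ?_
      · exact zero_add _
      · change a + ε • diff A (n - 1) n a' + -(ε • diff A (n - 1) n a') = a
        abel

lemma mem_Bd_bot (p n : ℤ) (hp : p = n) (a : A.X n) :
    (S.pair 0 a) ∈ S.columnFiltration.Bd 2 p n ↔
      ∃ a' : A.X (n - 1), S.map (n - 1) n a' = 0 ∧ a = diff A (n - 1) n a' := by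
  subst hp
  constructor
  · intro hx
    obtain ⟨y, hy, _, ⟨z, hz, rfl⟩, e⟩ := Submodule.mem_sup.1 hx
    obtain ⟨y1, y2, rfl⟩ := S.exists_pair y
    obtain ⟨b', a', rfl⟩ := S.exists_pair z
    have hy2 : y2 = 0 := hy.1.2 (by omega)
    have hb' : b' = 0 := hz.1.1 (by omega)
    have hz' : diff B (p - 1) (p - 1 + 1) b' + S.map (p - 1) (p - 1 + 1) a' = 0 :=
      hz.2.1 (by omega)
    have e2 : y2 + -(ε • diff A (p - 1) p a') = a := congrArg (S.toA _) e
    rw [hb', map_zero, zero_add, S.map_eq_zero_congr _ _ p (by omega)] at hz'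
    refine ⟨-(ε • a'), ?_, ?_⟩
    · rw [map_neg, map_units_zsmul, hz', smul_zero, neg_zero]
    · rw [map_neg, map_units_zsmul, ← e2, hy2, zero_add]
  · rintro ⟨a', h, rfl⟩
    refine Submodule.mem_sup_right ⟨(S.pair 0 (-(ε • a'))), ?_, ?_⟩
    · refine ⟨⟨fun _ => rfl, fun h' => by omega⟩, fun _ => ?_, fun h' => by omega⟩
      change diff B (p - 1) (p - 1 + 1) 0 + S.map (p - 1) (p - 1 + 1) (-(ε • a')) = 0
      rw [map_zero, zero_add, map_neg, map_units_zsmul,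
        (S.map_eq_zero_congr _ _ p (by omega) a').2 h, smul_zero, neg_zero]
    · rw [cone_diff]
      refine S.cone_ext ?_ ?_
      · change diff B (p - 1) p 0 + S.map (p - 1) p (-(ε • a')) = 0
        rw [map_zero, zero_add, map_neg, map_units_zsmul, h, smul_zero, neg_zero]
      · change -(ε • diff A (p - 1) p (-(ε • a'))) = diff A (p - 1) p a'
        rw [map_neg, map_units_zsmul, smul_neg, neg_neg, smul_smul, Int.units_mul_self, one_smul]

/-- `(b, a) ↦ [b]`, from `Z_2` in the row of `B` to `H^n(C)`. -/
def topClass (p n : ℤ) (hp : p = n - 1) :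
    S.columnFiltration.Z 2 p n →ₗ[k] S.cokerComplex.homology n :=
  cls S.cokerComplex n ∘ₗ
    LinearMap.restrict (p := S.columnFiltration.Z 2 p n) (q := cocycles S.cokerComplex n)
      (S.toCoker n ∘ₗ S.toB n) (by
        intro x h
        obtain ⟨b, a, rfl⟩ := S.exists_pair x
        rw [mem_Z_top S p n hp, ← eq_neg_iff_add_eq_zero] at h
        change Submodule.mkQ _ (diff B n (n + 1) b) = 0
        rw [h, ← map_neg, Submodule.mkQ_apply, Submodule.Quotient.mk_eq_zero]
        exact S.mem_range _ _ _)

/-- `(0, a) ↦ [a]`, from `Z_2` in the row of `A` to `H^n(K)`. -/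
def botClass (p n : ℤ) (hp : p = n) :
    S.columnFiltration.Z 2 p n →ₗ[k] S.kerComplex.homology n :=
  cls S.kerComplex n ∘ₗ
    LinearMap.codRestrict (cocycles S.kerComplex n)
      (LinearMap.codRestrict (LinearMap.ker (S.map n (n + 1)))
        (S.toA n ∘ₗ (S.columnFiltration.Z 2 p n).subtype)
        (by
          rintro ⟨x, h⟩
          obtain ⟨b, a, rfl⟩ := S.exists_pair x
          exact ((mem_Z_bot S p n hp b a).1 h).2.1))
      (by
        rintro ⟨x, h⟩
        obtain ⟨b, a, rfl⟩ := S.exists_pair x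
        exact Subtype.ext ((mem_Z_bot S p n hp b a).1 h).2.2)

/-- The identification of the row of `B` on the second page with the cohomology of `C`;
the class of `(b, a)` with `d b + S a = 0` goes to the class of `b`. -/
def pageTwoTop (p n : ℤ) (hp : p = n - 1) :
    S.columnFiltration.page 2 p n ≃ₗ[k] S.cokerComplex.homology n :=
  (Submodule.quotEquivOfEq _ _ (by
    ext ⟨x, h⟩
    obtain ⟨b, a, rfl⟩ := S.exists_pair x
    rw [LinearMap.mem_ker, topClass, LinearMap.comp_apply, cls_eq_zero_iff]
    change (S.pair b a) ∈ S.columnFiltration.Bd 2 p n ↔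
      S.toCoker n b ∈ coboundaries S.cokerComplex n
    rw [mem_Bd_top S p n hp b a h]
    constructor
    · rintro ⟨b', a', rfl⟩
      refine ⟨Submodule.mkQ _ b', ?_⟩
      change S.toCoker n (diff B (n - 1) n b') = _
      rw [map_add, left_eq_add]
      refine (Submodule.Quotient.mk_eq_zero _).2 ?_
      exact ⟨a', rfl⟩
    · rintro ⟨c, hc⟩
      obtain ⟨b', rfl⟩ := Submodule.mkQ_surjective _ c
      have hc' : Submodule.mkQ (LinearMap.range (S.map (n - 1) n)) b =
        Submodule.mkQ _ (diff B (n - 1) n b') := hc.symm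
      obtain ⟨a', ha'⟩ := (Submodule.Quotient.eq _).1 hc'
      exact ⟨b', a', by rw [ha']; abel⟩)).trans
  ((S.topClass p n hp).quotKerEquivOfSurjective (by
    intro x
    obtain ⟨⟨c, hc⟩, rfl⟩ := cls_surjective _ _ x
    obtain ⟨b, rfl⟩ := Submodule.mkQ_surjective _ c
    have hb : Submodule.mkQ _ (diff B n (n + 1) b) = 0 := hc
    rw [Submodule.mkQ_apply, Submodule.Quotient.mk_eq_zero] at hb
    obtain ⟨a, ha⟩ := S.exists_of_mem_range n (n + 1) rfl _ hb
    refine ⟨⟨(S.pair b (-a)), ?_⟩, rfl⟩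
    rw [mem_Z_top S p n hp, map_neg, ha, add_neg_cancel]))

/-- The identification of the row of `A` on the second page with the cohomology of `K`;
the class of `(0, a)` with `S a = 0` and `d a = 0` goes to the class of `a`. -/
def pageTwoBot (p n : ℤ) (hp : p = n) :
    S.columnFiltration.page 2 p n ≃ₗ[k] S.kerComplex.homology n :=
  (Submodule.quotEquivOfEq _ _ (by
    ext ⟨x, h⟩
    obtain ⟨b, a, rfl⟩ := S.exists_pair x
    rw [LinearMap.mem_ker, botClass, LinearMap.comp_apply, cls_eq_zero_iff]
    obtain ⟨rfl, h1, h2⟩ := (mem_Z_bot S p n hp b a).1 h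
    change (S.pair 0 a) ∈ S.columnFiltration.Bd 2 p n ↔
      S.kerMk a h1 ∈ coboundaries S.kerComplex n
    rw [mem_Bd_bot S p n hp a]
    constructor
    · rintro ⟨a', h', rfl⟩
      exact ⟨⟨a', (S.map_eq_zero_congr _ _ _ (by omega) a').2 h'⟩, rfl⟩
    · rintro ⟨⟨a', h'⟩, e⟩
      exact ⟨a', (S.map_eq_zero_congr _ _ _ (by omega) a').1 h',
        (congrArg Subtype.val e).symm⟩)).trans
  ((S.botClass p n hp).quotKerEquivOfSurjective (by
    intro x
    obtain ⟨⟨c, hc⟩, rfl⟩ := cls_surjective _ _ x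
    obtain ⟨a, ha⟩ := c
    exact ⟨⟨(S.pair 0 a), (mem_Z_bot S p n hp 0 a).2
      ⟨rfl, ha, congrArg Subtype.val hc⟩⟩, rfl⟩))

/-- The maps `φ^i : H^i(C) → H^{i+1}(K)`: the differential of the second page. -/
def phi (i j : ℤ) (h : i + 1 = j) :
    S.cokerComplex.homology i →ₗ[k] S.kerComplex.homology j :=
  (S.pageTwoBot j j rfl).toLinearMap ∘ₗ
    S.columnFiltration.pageDiff 2 (i - 1) j i j (by omega) h ∘ₗ
    (S.pageTwoTop (i - 1) i rfl).symm.toLinearMap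

/-- Explicitly: if `d b + S a = 0`, then `φ [b] = [-ε d a]`. -/
lemma phi_cls (i j : ℤ) (h : i + 1 = j) (b : B.X i) (a : A.X i)
    (hba : diff B i j b + S.map i j a = 0)
    (hb : S.toCoker i b ∈ cocycles S.cokerComplex i)
    (ha : S.map j (j + 1) (-(ε • diff A i j a)) = 0)
    (ha' : S.kerMk (-(ε • diff A i j a)) ha ∈ cocycles S.kerComplex j) :
    S.phi i j h (cls S.cokerComplex i ⟨S.toCoker i b, hb⟩) =
      cls S.kerComplex j ⟨S.kerMk (-(ε • diff A i j a)) ha, ha'⟩ := by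
  subst h
  have hz := (S.mem_Z_top (i - 1) i rfl b a).2 hba
  have e : cls S.cokerComplex i ⟨S.toCoker i b, hb⟩ =
      S.pageTwoTop (i - 1) i rfl (Submodule.mkQ _ ⟨S.pair b a, hz⟩) := rfl
  rw [e, phi, LinearMap.comp_apply, LinearMap.comp_apply, LinearEquiv.coe_coe, LinearEquiv.coe_coe,
    LinearEquiv.symm_apply_apply]
  rfl

end DegOneMap

end

end BGG

namespace BGG

noncomputable section

variable {k : Type u} [Field k]

/-! The cohomology of the total complex `Z = S.cone` is computed in two ways. The subcomplex `B`
with quotient `A` (up to the sign of its differential) gives a long exact sequence whose connecting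
map is induced by `S`. Over a field it splits in each degree, so `H^i(Z)` is the sum of the cokernel
and the kernel of consecutive maps `S_*`, that is, of `H^i(B)` and `H^i(A)` when `S_* = 0`.

Since the column filtration has only two rows, the second page yields an exact sequence `H^{i-1}(C)
→ H^i(K) → H^i(Z) → H^i(C) → H^{i+1}(K)` with outer maps `φ`. Its exactness is checked on cocycles
through `phi_cls`, without a convergence argument. Hence `H^i(Z)` is also `coker φ ⊕ ker φ`.

Finally, `Φ` is itself a map of degree one, so the first computation applies to its cone with `Φ_* =
φ`. No map between `Y_Φ` and `Z` is needed: both have cohomology `coker φ ⊕ ker φ`. -/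

/-- In an exact sequence `V → X → Y → W → U` of vector spaces, the middle term is the direct sum
of the cokernel of the first map and the kernel of the last one. -/
lemma nonempty_equiv_coker_prod_ker {V X Y W U : Type*} [AddCommGroup V] [AddCommGroup X]
    [AddCommGroup Y] [AddCommGroup W] [AddCommGroup U] [Module k V] [Module k X] [Module k Y]
    [Module k W] [Module k U] {f : V →ₗ[k] X} {g : X →ₗ[k] Y} {h : Y →ₗ[k] W} {m : W →ₗ[k] U}
    (hfg : Function.Exact f g) (hgh : Function.Exact g h) (hhm : Function.Exact h m) :
    Nonempty (Y ≃ₗ[k] (X ⧸ LinearMap.range f) × LinearMap.ker m) := by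
  -- The splitting uses that `k` is a field: `Y = ker h ⊕ q`, where `ker h = im g ≅ X / im f` and `q
  -- ≅ Y / ker h ≅ im h = ker m`.
  obtain ⟨q, hq⟩ := Submodule.exists_isCompl (LinearMap.ker h)
  let e₁ : (X ⧸ LinearMap.range f) ≃ₗ[k] LinearMap.ker h :=
    (Submodule.quotEquivOfEq _ _ hfg.linearMap_ker_eq.symm).trans
      (g.quotKerEquivRange.trans (LinearEquiv.ofEq _ _ hgh.linearMap_ker_eq.symm))
  let e₂ : LinearMap.ker m ≃ₗ[k] q :=
    (LinearEquiv.ofEq _ _ hhm.linearMap_ker_eq).trans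
      (h.quotKerEquivRange.symm.trans (Submodule.quotientEquivOfIsCompl _ q hq))
  exact ⟨((e₁.prodCongr e₂).trans (Submodule.prodEquivOfIsCompl _ q hq)).symm⟩

/-! ### Cohomology classes and maps induced on cohomology. -/

/-- Needed in degree `i - 1`, where the target degree `i - 1 + 1` of `cocycles` is not syntactically
`i`. -/
lemma mem_cocycles_iff (X : Cplx.{u, v} k) {i j : ℤ} (h : i + 1 = j) (x : X.X i) :
    x ∈ cocycles X i ↔ diff X i j x = 0 := by
  subst h
  exact LinearMap.mem_ker

lemma cls_eq_cls_iff (X : Cplx.{u, v} k) (i : ℤ) (x y : cocycles X i) :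
    cls X i x = cls X i y ↔ ∃ z, diff X (i - 1) i z = x - y := by
  rw [← sub_eq_zero, ← map_sub, cls_eq_zero_iff]
  rfl

/-- The map on cohomology induced by a linear map between the terms in degree `i` of two complexes
that preserves cocycles and coboundaries. -/
def homologyLift (X Y : Cplx.{u, v} k) (i : ℤ) (f : X.X i →ₗ[k] Y.X i)
    (hZ : ∀ x ∈ cocycles X i, f x ∈ cocycles Y i)
    (hB : ∀ x ∈ coboundaries X i, f x ∈ coboundaries Y i) : X.homology i →ₗ[k] Y.homology i :=
  (Submodule.liftQ _ (cls Y i ∘ₗ f.restrict hZ) (by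
    intro x hx
    rw [LinearMap.mem_ker, LinearMap.comp_apply, cls_eq_zero_iff]
    exact hB x hx)) ∘ₗ (homologyEquiv X i).symm.toLinearMap

lemma homologyLift_cls (X Y : Cplx.{u, v} k) (i : ℤ) (f : X.X i →ₗ[k] Y.X i)
    (hZ : ∀ x ∈ cocycles X i, f x ∈ cocycles Y i)
    (hB : ∀ x ∈ coboundaries X i, f x ∈ coboundaries Y i) (x : cocycles X i) :
    homologyLift X Y i f hZ hB (cls X i x) = cls Y i ⟨f x, hZ x x.2⟩ := by
  simp only [homologyLift, cls, LinearMap.comp_apply, LinearEquiv.coe_coe,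
    LinearEquiv.symm_apply_apply]
  rfl

namespace DegOneMap

variable {ε : ℤˣ} {A B : Cplx.{u, v} k} (S : DegOneMap ε A B)

/-! ### Elements and cocycles of the cone. -/

lemma pair_eq_pair_iff {i : ℤ} {b b' : B.X i} {a a' : A.X i} :
    S.pair b a = S.pair b' a' ↔ b = b' ∧ a = a' := Prod.mk_inj

lemma pair_eq_zero_iff {i : ℤ} {b : B.X i} {a : A.X i} :
    S.pair b a = 0 ↔ b = 0 ∧ a = 0 := Prod.mk_eq_zero

lemma pair_sub_pair {i : ℤ} (b b' : B.X i) (a a' : A.X i) :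
    S.pair b a - S.pair b' a' = S.pair (b - b') (a - a') := rfl

lemma cone_diff_eq_zero_iff (i j : ℤ) (b : B.X i) (a : A.X i) :
    diff S.cone i j (S.pair b a) = 0 ↔ diff B i j b + S.map i j a = 0 ∧ diff A i j a = 0 := by
  rw [cone_diff, pair_eq_zero_iff, neg_eq_zero, smul_eq_zero_iff_eq]

lemma pair_mem_cocycles (i : ℤ) (b : B.X i) (a : A.X i) :
    S.pair b a ∈ cocycles S.cone i ↔
      diff B i (i + 1) b + S.map i (i + 1) a = 0 ∧ diff A i (i + 1) a = 0 :=
  LinearMap.mem_ker.trans (S.cone_diff_eq_zero_iff i (i + 1) b a)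

lemma kerMk_mem_cocycles (i : ℤ) (a : A.X i) (h : S.map i (i + 1) a = 0) :
    S.kerMk a h ∈ cocycles S.kerComplex i ↔ diff A i (i + 1) a = 0 :=
  ⟨fun h' => congrArg Subtype.val h', fun h' => Subtype.ext h'⟩

lemma toCoker_surjective (i : ℤ) : Function.Surjective (S.toCoker i) :=
  Submodule.mkQ_surjective _

lemma toCoker_eq_zero_iff (i j : ℤ) (h : i + 1 = j) (b : B.X j) :
    S.toCoker j b = 0 ↔ ∃ a : A.X i, S.map i j a = b := by
  obtain rfl : i = j - 1 := by omega
  exact Submodule.Quotient.mk_eq_zero _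

lemma diff_toCoker (i j : ℤ) (b : B.X i) :
    diff S.cokerComplex i j (S.toCoker i b) = S.toCoker j (diff B i j b) := rfl

/-! ### Maps relating the cohomology of the cone to that of `A`, `B`, `K` and `C`. -/

/-- The map `H^i(B) → H^i(cone S)`, `[b] ↦ [(b, 0)]`. -/
def inclB (i : ℤ) : B.homology i →ₗ[k] S.cone.homology i :=
  homologyLift B S.cone i (LinearMap.inl k (B.X i) (A.X i))
    (fun b hb => (S.pair_mem_cocycles i b 0).2 ⟨by rw [LinearMap.mem_ker.1 hb]; simp, map_zero _⟩)
    (by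
      rintro _ ⟨b, rfl⟩
      refine ⟨S.pair b 0, ?_⟩
      rw [cone_diff]
      refine (S.pair_eq_pair_iff (b' := diff B (i - 1) i b) (a' := 0)).2 ⟨?_, ?_⟩
      · rw [map_zero, add_zero]
      · rw [map_zero, smul_zero, neg_zero])

/-- The map `H^i(cone S) → H^i(A)`, `[(b, a)] ↦ [a]`. -/
def projA (i : ℤ) : S.cone.homology i →ₗ[k] A.homology i :=
  homologyLift S.cone A i (S.toA i)
    (by
      intro x hx
      obtain ⟨b, a, rfl⟩ := S.exists_pair x
      exact ((S.pair_mem_cocycles i b a).1 hx).2)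
    (by
      rintro _ ⟨x, rfl⟩
      obtain ⟨b, a, rfl⟩ := S.exists_pair x
      -- The projection commutes with the differentials only up to the factor `-ε`, which is
      -- absorbed into the primitive.
      exact ⟨-(ε • a), by rw [map_neg, map_units_zsmul]; rfl⟩)

/-- The map `H^i(K) → H^i(cone S)`, `[a] ↦ [(0, a)]`. -/
def inclKer (i : ℤ) : S.kerComplex.homology i →ₗ[k] S.cone.homology i :=
  homologyLift S.kerComplex S.cone i (LinearMap.inr k (B.X i) (A.X i) ∘ₗ S.kerIncl i)
    (by
      rintro ⟨a, ha⟩ h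
      exact (S.pair_mem_cocycles i 0 a).2
        ⟨by rw [map_zero, zero_add]; exact ha, (S.kerMk_mem_cocycles i a ha).1 h⟩)
    (by
      rintro _ ⟨⟨a, ha⟩, rfl⟩
      -- The factor `-ε` cancels the one in the differential of the cone, as `ε² = 1`.
      refine ⟨S.pair 0 (-(ε • a)), ?_⟩
      rw [cone_diff]
      have ha' : S.map (i - 1) i a = 0 := (S.map_eq_zero_congr _ _ _ (by omega) a).1 ha
      refine (S.pair_eq_pair_iff (b' := 0) (a' := diff A (i - 1) i a)).2 ⟨?_, ?_⟩
      · rw [map_zero, zero_add, map_neg, map_units_zsmul, ha', smul_zero, neg_zero]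
      · rw [map_neg, map_units_zsmul, smul_neg, neg_neg, smul_smul, Int.units_mul_self, one_smul])

/-- The map `H^i(cone S) → H^i(C)`, `[(b, a)] ↦ [b]`. -/
def projCoker (i : ℤ) : S.cone.homology i →ₗ[k] S.cokerComplex.homology i :=
  homologyLift S.cone S.cokerComplex i (S.toCoker i ∘ₗ S.toB i)
    (by
      intro x hx
      obtain ⟨b, a, rfl⟩ := S.exists_pair x
      have h := ((S.pair_mem_cocycles i b a).1 hx).1
      rw [LinearMap.mem_ker]
      refine (S.toCoker_eq_zero_iff i (i + 1) rfl _).2 ⟨-a, ?_⟩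
      rw [map_neg]
      exact (eq_neg_of_add_eq_zero_left h).symm)
    (by
      rintro _ ⟨x, rfl⟩
      obtain ⟨b, a, rfl⟩ := S.exists_pair x
      refine ⟨S.toCoker (i - 1) b, ?_⟩
      change S.toCoker i (diff B (i - 1) i b) =
        S.toCoker i (diff B (i - 1) i b + S.map (i - 1) i a)
      rw [map_add, (S.toCoker_eq_zero_iff (i - 1) i (by omega) _).2 ⟨a, rfl⟩, add_zero])

lemma inclB_cls (i : ℤ) (b : B.X i) (hb : b ∈ cocycles B i)
    (h : S.pair b 0 ∈ cocycles S.cone i) :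
    S.inclB i (cls B i ⟨b, hb⟩) = cls S.cone i ⟨S.pair b 0, h⟩ :=
  homologyLift_cls _ _ _ _ _ _ _

lemma projA_cls (i : ℤ) (b : B.X i) (a : A.X i) (h : S.pair b a ∈ cocycles S.cone i)
    (ha : a ∈ cocycles A i) :
    S.projA i (cls S.cone i ⟨S.pair b a, h⟩) = cls A i ⟨a, ha⟩ :=
  homologyLift_cls _ _ _ _ _ _ _

lemma inclKer_cls (i : ℤ) (a : A.X i) (ha : S.map i (i + 1) a = 0)
    (ha' : S.kerMk a ha ∈ cocycles S.kerComplex i) (h : S.pair 0 a ∈ cocycles S.cone i) :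
    S.inclKer i (cls S.kerComplex i ⟨S.kerMk a ha, ha'⟩) = cls S.cone i ⟨S.pair 0 a, h⟩ :=
  homologyLift_cls _ _ _ _ _ _ _

lemma projCoker_cls (i : ℤ) (b : B.X i) (a : A.X i) (h : S.pair b a ∈ cocycles S.cone i)
    (hb : S.toCoker i b ∈ cocycles S.cokerComplex i) :
    S.projCoker i (cls S.cone i ⟨S.pair b a, h⟩) = cls S.cokerComplex i ⟨S.toCoker i b, hb⟩ :=
  homologyLift_cls _ _ _ _ _ _ _

lemma map_mem_cocycles (i j : ℤ) (a : A.X i) (h : i + 1 = j) (ha : a ∈ cocycles A i) :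
    S.map i j a ∈ cocycles B j := by
  subst h
  rw [LinearMap.mem_ker] at ha ⊢
  rw [S.comm', ha, map_zero, smul_zero]

/-! ### The long exact sequence of the cone. -/

/-- The equation `(b, 0) = d(b', a')` says that `a'` is a cocycle and `b = d b' + S a'`, so `[b] =
S_*[a']`. -/
lemma exact_onCohomology_inclB (i : ℤ) :
    Function.Exact (S.onCohomology (i - 1) i (sub_add_cancel i 1)) (S.inclB i) := by
  intro y
  obtain ⟨⟨b, hb⟩, rfl⟩ := cls_surjective _ _ y
  have hb' : S.pair b 0 ∈ cocycles S.cone i :=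
    (S.pair_mem_cocycles i b 0).2 ⟨by rw [LinearMap.mem_ker.1 hb]; simp, map_zero _⟩
  rw [S.inclB_cls i b hb hb', cls_eq_zero_iff]
  constructor
  · rintro ⟨x, hx⟩
    obtain ⟨b', a', rfl⟩ := S.exists_pair x
    rw [cone_diff, pair_eq_pair_iff, neg_eq_zero, smul_eq_zero_iff_eq] at hx
    have ha' : a' ∈ cocycles A (i - 1) := (mem_cocycles_iff A (by omega) a').2 hx.2
    have hm := S.map_mem_cocycles (i - 1) i a' (by omega) ha'
    refine ⟨cls A (i - 1) ⟨a', ha'⟩, ?_⟩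
    rw [S.onCohomology_cls _ _ _ _ hm, cls_eq_cls_iff]
    refine ⟨-b', ?_⟩
    change _ = S.map (i - 1) i a' - b
    rw [map_neg, ← hx.1]
    abel
  · rintro ⟨y, hy⟩
    obtain ⟨⟨a', ha'⟩, rfl⟩ := cls_surjective _ _ y
    have hm := S.map_mem_cocycles (i - 1) i a' (by omega) ha'
    rw [S.onCohomology_cls _ _ _ _ hm, cls_eq_cls_iff] at hy
    obtain ⟨z, hz⟩ := hy
    change _ = S.map (i - 1) i a' - b at hz
    refine ⟨S.pair (-z) a', ?_⟩
    rw [cone_diff, pair_eq_pair_iff, (mem_cocycles_iff A (by omega) a').1 ha', map_neg, hz]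
    simp

lemma exact_inclB_projA (i : ℤ) : Function.Exact (S.inclB i) (S.projA i) := by
  intro y
  obtain ⟨⟨x, hx⟩, rfl⟩ := cls_surjective _ _ y
  obtain ⟨b, a, rfl⟩ := S.exists_pair x
  obtain ⟨h1, h2⟩ := (S.pair_mem_cocycles i b a).1 hx
  rw [S.projA_cls i b a hx h2, cls_eq_zero_iff]
  constructor
  · rintro ⟨a', rfl⟩
    -- With `a = d a'`, adding the coboundary `d(0, ε a') = (ε S a', -d a')` to `(b, a)` removes its
    -- component in `A`.
    have hb : b + ε • S.map (i - 1) i a' ∈ cocycles B i := by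
      rw [LinearMap.mem_ker, map_add, map_units_zsmul, ← S.comm, h1]
    have hb' : S.pair (b + ε • S.map (i - 1) i a') 0 ∈ cocycles S.cone i :=
      (S.pair_mem_cocycles i _ 0).2 ⟨by rw [LinearMap.mem_ker.1 hb]; simp, map_zero _⟩
    refine ⟨cls B i ⟨_, hb⟩, ?_⟩
    rw [S.inclB_cls i _ hb hb', cls_eq_cls_iff]
    refine ⟨S.pair 0 (ε • a'), ?_⟩
    rw [cone_diff, pair_sub_pair, pair_eq_pair_iff]
    simp [smul_smul]
  · rintro ⟨y, hy⟩
    obtain ⟨⟨b', hb⟩, rfl⟩ := cls_surjective _ _ y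
    have hb' : S.pair b' 0 ∈ cocycles S.cone i :=
      (S.pair_mem_cocycles i _ 0).2 ⟨by rw [LinearMap.mem_ker.1 hb]; simp, map_zero _⟩
    rw [S.inclB_cls i b' hb hb', cls_eq_cls_iff] at hy
    obtain ⟨z, hz⟩ := hy
    obtain ⟨b'', a'', rfl⟩ := S.exists_pair z
    rw [cone_diff, pair_sub_pair, pair_eq_pair_iff] at hz
    refine ⟨ε • a'', ?_⟩
    rw [map_units_zsmul]
    simpa using hz.2

/-- A cocycle `a` is the second component of a cocycle of the cone exactly when `S a` is a
coboundary. -/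
lemma exact_projA_onCohomology (i : ℤ) :
    Function.Exact (S.projA i) (S.onCohomology i (i + 1) rfl) := by
  intro y
  obtain ⟨⟨a, ha⟩, rfl⟩ := cls_surjective _ _ y
  have hm := S.map_mem_cocycles i (i + 1) a rfl ha
  rw [S.onCohomology_cls _ _ _ _ hm, cls_eq_zero_iff]
  constructor
  · intro h
    obtain ⟨b, hb⟩ : ∃ b : B.X i, diff B i (i + 1) b = S.map i (i + 1) a := by
      -- The primitive lives in degree `i + 1 - 1` and has to be transported to degree `i`.
      have key : ∀ j : ℤ, j = i → (∃ b : B.X j, diff B j (i + 1) b = S.map i (i + 1) a) →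
          ∃ b : B.X i, diff B i (i + 1) b = S.map i (i + 1) a := by
        rintro j rfl h
        exact h
      exact key _ (by omega) h
    have hx : S.pair (-b) a ∈ cocycles S.cone i :=
      (S.pair_mem_cocycles i _ a).2 ⟨by rw [map_neg, hb, neg_add_cancel], ha⟩
    exact ⟨cls S.cone i ⟨_, hx⟩, S.projA_cls i _ a hx ha⟩
  · rintro ⟨y, hy⟩
    obtain ⟨⟨x, hx⟩, rfl⟩ := cls_surjective _ _ y
    obtain ⟨b, a', rfl⟩ := S.exists_pair x
    obtain ⟨h1, h2⟩ := (S.pair_mem_cocycles i b a').1 hx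
    rw [S.projA_cls i b a' hx h2, cls_eq_cls_iff] at hy
    obtain ⟨z, hz⟩ := hy
    change _ = a' - a at hz
    -- Now `S a = S a' - S d z`, where `S a' = -d b` and `S d z = d(ε S z)` are coboundaries.
    obtain rfl : a = a' - diff A (i - 1) i z := by rw [hz]; abel
    change S.map i (i + 1) _ ∈ _
    rw [map_sub, S.comm, ← map_units_zsmul, eq_neg_of_add_eq_zero_right h1]
    exact Submodule.sub_mem _ (Submodule.neg_mem _ (diff_mem_coboundaries _ _ _ _))
      (diff_mem_coboundaries _ _ _ _)

/-- The cohomology of the mapping cone, from the long exact sequence. -/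
theorem nonempty_cone_homology_equiv (i : ℤ) :
    Nonempty (S.cone.homology i ≃ₗ[k]
      (B.homology i ⧸ LinearMap.range (S.onCohomology (i - 1) i (sub_add_cancel i 1))) ×
        LinearMap.ker (S.onCohomology i (i + 1) rfl)) :=
  nonempty_equiv_coker_prod_ker (S.exact_onCohomology_inclB i) (S.exact_inclB_projA i)
    (S.exact_projA_onCohomology i)

/-! ### The exact sequence of the second page. -/

/-- A class in `H^i(C)` has a representative `b` with `d b + S a = 0` for some `a`. -/
lemma exists_rep_coker (i j : ℤ) (h : i + 1 = j) (y : S.cokerComplex.homology i) :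
    ∃ (b : B.X i) (a : A.X i) (_ : diff B i j b + S.map i j a = 0)
      (hb : S.toCoker i b ∈ cocycles S.cokerComplex i),
      y = cls S.cokerComplex i ⟨S.toCoker i b, hb⟩ := by
  obtain ⟨⟨c, hc⟩, rfl⟩ := cls_surjective _ _ y
  obtain ⟨b, rfl⟩ := S.toCoker_surjective i c
  have hc' := (mem_cocycles_iff _ h _).1 hc
  rw [diff_toCoker, S.toCoker_eq_zero_iff i j h] at hc'
  obtain ⟨a, ha⟩ := hc'
  exact ⟨b, -a, by rw [map_neg, ha, add_neg_cancel], hc, rfl⟩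

lemma toCoker_mem_cocycles (i j : ℤ) (h : i + 1 = j) (b : B.X i) (a : A.X i)
    (hba : diff B i j b + S.map i j a = 0) : S.toCoker i b ∈ cocycles S.cokerComplex i := by
  rw [mem_cocycles_iff _ h, diff_toCoker, S.toCoker_eq_zero_iff i j h]
  exact ⟨-a, by rw [map_neg]; exact (eq_neg_of_add_eq_zero_left hba).symm⟩

/-- Here `S d a = ε d S a = -ε d d b = 0`, so `-ε d a` lies in `K` and `phi_cls` applies. -/
lemma map_diff_eq_zero (i j l : ℤ) (b : B.X i) (a : A.X i)
    (hba : diff B i j b + S.map i j a = 0) : S.map j l (-(ε • diff A i j a)) = 0 := by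
  rw [map_neg, map_units_zsmul, S.comm, eq_neg_of_add_eq_zero_right hba, map_neg, diff_diff]
  simp

lemma neg_diff_mem_cocycles (i j : ℤ) (a : A.X i)
    (h : S.map j (j + 1) (-(ε • diff A i j a)) = 0) :
    S.kerMk (-(ε • diff A i j a)) h ∈ cocycles S.kerComplex j := by
  rw [kerMk_mem_cocycles, map_neg, map_units_zsmul, diff_diff, smul_zero, neg_zero]

/-- The equation `(0, a) = d(b', a')` says `d b' + S a' = 0` and `a = -ε d a'`, which is the
explicit description of `φ[b'] = [a]`. -/
lemma exact_phi_inclKer (i : ℤ) :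
    Function.Exact (S.phi (i - 1) i (sub_add_cancel i 1)) (S.inclKer i) := by
  intro y
  constructor
  · intro hy
    obtain ⟨⟨⟨a, ha⟩, hc⟩, rfl⟩ := cls_surjective _ _ y
    have hd := (S.kerMk_mem_cocycles i a ha).1 hc
    have hx : S.pair 0 a ∈ cocycles S.cone i :=
      (S.pair_mem_cocycles i 0 a).2 ⟨by rw [map_zero, zero_add]; exact ha, hd⟩
    have hy' := (S.inclKer_cls i a ha hc hx).symm.trans hy
    rw [cls_eq_zero_iff] at hy'
    obtain ⟨z, hz⟩ := hy'
    obtain ⟨b', a', rfl⟩ := S.exists_pair z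
    rw [cone_diff, pair_eq_pair_iff] at hz
    obtain ⟨hz1, rfl⟩ := hz
    exact ⟨cls S.cokerComplex (i - 1) ⟨S.toCoker (i - 1) b',
      S.toCoker_mem_cocycles _ i (by omega) b' a' hz1⟩, S.phi_cls _ _ _ b' a' hz1 _ ha hc⟩
  · rintro ⟨w, rfl⟩
    obtain ⟨b, a, hba, hb, rfl⟩ := S.exists_rep_coker (i - 1) i (by omega) w
    have ha := S.map_diff_eq_zero (i - 1) i (i + 1) b a hba
    have ha' := S.neg_diff_mem_cocycles (i - 1) i a ha
    have hx : S.pair 0 (-(ε • diff A (i - 1) i a)) ∈ cocycles S.cone i :=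
      (S.pair_mem_cocycles i 0 _).2 ⟨by rw [map_zero, zero_add, ha],
        (S.kerMk_mem_cocycles i _ ha).1 ha'⟩
    rw [S.phi_cls _ _ _ b a hba hb ha ha', S.inclKer_cls i _ ha ha' hx, cls_eq_zero_iff]
    refine ⟨S.pair b a, ?_⟩
    rw [cone_diff, hba]

lemma exact_inclKer_projCoker (i : ℤ) : Function.Exact (S.inclKer i) (S.projCoker i) := by
  intro y
  constructor
  · intro hy
    obtain ⟨⟨x, hx⟩, rfl⟩ := cls_surjective _ _ y
    obtain ⟨b, a, rfl⟩ := S.exists_pair x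
    obtain ⟨h1, h2⟩ := (S.pair_mem_cocycles i b a).1 hx
    rw [S.projCoker_cls i b a hx (S.toCoker_mem_cocycles i _ rfl b a h1), cls_eq_zero_iff] at hy
    obtain ⟨c, hc⟩ := hy
    obtain ⟨b', rfl⟩ := S.toCoker_surjective _ c
    change S.toCoker i (diff B (i - 1) i b') = S.toCoker i b at hc
    rw [eq_comm, ← sub_eq_zero, ← map_sub, S.toCoker_eq_zero_iff (i - 1) i (by omega)] at hc
    obtain ⟨a', ha'⟩ := hc
    obtain rfl : b = diff B (i - 1) i b' + S.map (i - 1) i a' := by rw [ha']; abel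
    -- Subtracting `d(b', a')` from `(b, a)` leaves `(0, a + ε d a')`, whose second entry must be a
    -- cocycle of `K`.
    have hS : S.map i (i + 1) (a + ε • diff A (i - 1) i a') = 0 := by
      rw [map_add, diff_diff, zero_add, S.comm'] at h1
      rw [map_add, map_units_zsmul, add_comm (S.map _ _ a), h1]
    have hd : diff A i (i + 1) (a + ε • diff A (i - 1) i a') = 0 := by
      rw [map_add, map_units_zsmul, diff_diff, h2, smul_zero, add_zero]
    have hc := (S.kerMk_mem_cocycles i _ hS).2 hd
    have hx' : S.pair 0 (a + ε • diff A (i - 1) i a') ∈ cocycles S.cone i :=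
      (S.pair_mem_cocycles i 0 _).2 ⟨by rw [map_zero, zero_add, hS], hd⟩
    refine ⟨cls S.kerComplex i ⟨S.kerMk _ hS, hc⟩, ?_⟩
    rw [S.inclKer_cls i _ hS hc hx', cls_eq_cls_iff]
    refine ⟨S.pair (-b') (-a'), ?_⟩
    rw [cone_diff, pair_sub_pair, pair_eq_pair_iff]
    constructor
    · rw [map_neg, map_neg]
      abel
    · rw [map_neg, smul_neg]
      abel
  · rintro ⟨w, rfl⟩
    obtain ⟨⟨⟨a, ha⟩, hc⟩, rfl⟩ := cls_surjective _ _ w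
    have hx : S.pair 0 a ∈ cocycles S.cone i :=
      (S.pair_mem_cocycles i 0 a).2 ⟨by rw [map_zero, zero_add]; exact ha,
        (S.kerMk_mem_cocycles i a ha).1 hc⟩
    have h0 : S.toCoker i 0 ∈ cocycles S.cokerComplex i := by
      rw [map_zero]
      exact Submodule.zero_mem _
    refine (congrArg (S.projCoker i) (S.inclKer_cls i a ha hc hx)).trans ?_
    rw [S.projCoker_cls i 0 a hx h0, cls_eq_zero_iff]
    exact ⟨0, (map_zero _).trans (map_zero (S.toCoker i)).symm⟩

lemma exact_projCoker_phi (i : ℤ) :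
    Function.Exact (S.projCoker i) (S.phi i (i + 1) rfl) := by
  intro y
  constructor
  · intro hy
    obtain ⟨b, a, hba, hb, rfl⟩ := S.exists_rep_coker i (i + 1) rfl y
    have ha := S.map_diff_eq_zero i (i + 1) (i + 1 + 1) b a hba
    have ha' := S.neg_diff_mem_cocycles i (i + 1) a ha
    rw [S.phi_cls _ _ _ b a hba hb ha ha', cls_eq_zero_iff] at hy
    obtain ⟨a', hS, hd⟩ : ∃ a' : A.X i, S.map i (i + 1) a' = 0 ∧
        diff A i (i + 1) a' = -(ε • diff A i (i + 1) a) := by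
      have key : ∀ j : ℤ, j = i → (∃ a' : A.X j, S.map j (j + 1) a' = 0 ∧
          diff A j (i + 1) a' = -(ε • diff A i (i + 1) a)) →
          ∃ a' : A.X i, S.map i (i + 1) a' = 0 ∧
            diff A i (i + 1) a' = -(ε • diff A i (i + 1) a) := by
        rintro j rfl h
        exact h
      obtain ⟨⟨a', hS⟩, hd⟩ := hy
      exact key _ (by omega) ⟨a', hS, congrArg Subtype.val hd⟩
    -- Vanishing of `φ[b]` gives `a'` in `K` with `d a' = -ε d a`. Replacing `a` by `a + ε a'` keeps
    -- `d b + S a = 0` and makes the `A`-component closed.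
    have hx : S.pair b (a + ε • a') ∈ cocycles S.cone i := by
      rw [pair_mem_cocycles, map_add, map_add, map_units_zsmul, map_units_zsmul, hS, hd]
      constructor
      · rw [smul_zero, add_zero, hba]
      · rw [smul_neg, smul_smul, Int.units_mul_self, one_smul, add_neg_cancel]
    exact ⟨cls S.cone i ⟨_, hx⟩, S.projCoker_cls i b _ hx hb⟩
  · rintro ⟨w, rfl⟩
    obtain ⟨⟨x, hx⟩, rfl⟩ := cls_surjective _ _ w
    obtain ⟨b, a, rfl⟩ := S.exists_pair x
    obtain ⟨h1, h2⟩ := (S.pair_mem_cocycles i b a).1 hx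
    have hb := S.toCoker_mem_cocycles i _ rfl b a h1
    have ha := S.map_diff_eq_zero i (i + 1) (i + 1 + 1) b a h1
    have ha' := S.neg_diff_mem_cocycles i (i + 1) a ha
    rw [S.projCoker_cls i b a hx hb, S.phi_cls _ _ _ b a h1 hb ha ha', cls_eq_zero_iff]
    -- For a cocycle `(b, a)` of the cone, `d a = 0`, so the representative `-ε d a` of `φ[b]` is
    -- itself zero.
    have h0 : S.kerMk (-(ε • diff A i (i + 1) a)) ha = 0 :=
      Subtype.ext (show -(ε • diff A i (i + 1) a) = 0 by rw [h2, smul_zero, neg_zero])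
    exact ⟨0, (map_zero _).trans h0.symm⟩

/-- The cohomology of the mapping cone, from the second page of the spectral sequence of the
filtration by columns. -/
theorem nonempty_cone_homology_equiv_phi (i : ℤ) :
    Nonempty (S.cone.homology i ≃ₗ[k]
      (S.kerComplex.homology i ⧸ LinearMap.range (S.phi (i - 1) i (sub_add_cancel i 1))) ×
        LinearMap.ker (S.phi i (i + 1) rfl)) :=
  nonempty_equiv_coker_prod_ker (S.exact_phi_inclKer i) (S.exact_inclKer_projCoker i)
    (S.exact_projCoker_phi i)

end DegOneMap

end

end BGG

theorem mainTheorem4 {k : Type u} [Field k] (ε η : ℤˣ)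
    (A B : CochainComplex (ModuleCat.{v} k) ℤ)
    (S : BGG.DegOneMap ε A B)
    (hS : ∀ (i j : ℤ) (h : i + 1 = j), S.onCohomology i j h = 0)
    (Φ : BGG.DegOneMap η S.cokerComplex S.kerComplex)
    (hΦ : ∀ (i j : ℤ) (h : i + 1 = j), Φ.onCohomology i j h = S.phi i j h)
    (i : ℤ) :
    Nonempty (Φ.cone.homology i ≃ₗ[k]
      (S.kerComplex.homology i ⧸ LinearMap.range (S.phi (i - 1) i (sub_add_cancel i 1))) ×
        LinearMap.ker (S.phi i (i + 1) rfl)) ∧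
    Nonempty (((S.kerComplex.homology i ⧸
        LinearMap.range (S.phi (i - 1) i (sub_add_cancel i 1))) ×
        LinearMap.ker (S.phi i (i + 1) rfl)) ≃ₗ[k]
      A.homology i × B.homology i) := by
  constructor
  -- Once `φ` is written as `Φ_*`, this is the long exact sequence of the cone of `Φ`.
  · rw [← hΦ, ← hΦ]
    exact Φ.nonempty_cone_homology_equiv i
  -- The two computations of `H^i(Z)` are compared; `S_* = 0` turns the cokernel into `H^i(B)` and
  -- the kernel into `H^i(A)`.
  · obtain ⟨e⟩ := S.nonempty_cone_homology_equiv i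
    obtain ⟨e'⟩ := S.nonempty_cone_homology_equiv_phi i
    have hr : LinearMap.range (S.onCohomology (i - 1) i (sub_add_cancel i 1)) = ⊥ := by
      rw [hS, LinearMap.range_zero]
    have hk : LinearMap.ker (S.onCohomology i (i + 1) rfl) = ⊤ := by
      rw [hS, LinearMap.ker_zero]
    exact ⟨(e'.symm.trans e).trans (((Submodule.quotEquivOfEqBot _ hr).prodCongr
      (LinearEquiv.ofTop _ hk)).trans (LinearEquiv.prodComm k _ _))⟩
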